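/- Let $G$ be a finite simple graph, let $L=\{L_v:v\in V(G)\}$ be a system of finite sets $L_v\subset\mathbb{R}$ (lists of colors), and let $P_G=\prod_{(u,v)\in E(\vec G)}(x_v-x_u)$ be the graph polynomial of $G$ with respect to an arbitrary orientation $\vec G$ of $G$. An $L$-coloring of $G$ is a function $\varphi$ with $\varphi(v)\in L_v$ for every $v\in V(G)$ and $\varphi(u)\neq\varphi(v)$ for every $uv\in E(G)$. For a color $c\in\mathbb{R}$ and $v\in V(G)$, let $\chi_{L,c}(v)=1$ if $c\in L_v$ and $\chi_{L,c}(v)=0$ otherwise; let $1_v:V(G)\to\{0,1\}$ be the function that is $1$ at $v$ and $0$ elsewhere; and for $g:V(G)\to\mathbb{Z}$ let $[x^g]\,P_G$ denote the coefficient of the monomial $\prod_{v} x_v^{g(v)}$ in $P_G$ (which is $0$ if $g$ has a negative value). Suppose that $f:V(G)\to\mathbb{Z}$ satisfies $f(v)<|L_v|$ for every $v\in V(G)$ and $\sum_{v\in V(G)}f(v)=|E(G)|-2$. If $G$ has no $L$-coloring, then for every color $c\in\mathbb{R}$ $$\sum_{\{u,v\}\subseteq V(G)}[x^{f+1_u+1_v}]\,P_G\cdot\chi_{L,c}(u)\chi_{L,c}(v)+\sum_{v\in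 V(G)}[x^{f+2\cdot 1_v}]\,P_G\cdot\chi_{L,c}(v)=0,$$ and for any distinct colors $c_1,c_2\in\mathbb{R}$ $$\sum_{\{u,v\}\subseteq V(G)}[x^{f+1_u+1_v}]\,P_G\cdot\bigl(\chi_{L,c_1}(u)\chi_{L,c_2}(v)+\chi_{L,c_2}(u)\chi_{L,c_1}(v)\bigr)+\sum_{v\in V(G)}[x^{f+2\cdot 1_v}]\,P_G\cdot\chi_{L,c_1}(v)\chi_{L,c_2}(v)=0.$$ Here the sums over $\{u,v\}\subseteq V(G)$ range over all unordered pairs of distinct vertices. -/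

import Mathlib

open MvPolynomial

/-- An orientation of a simple graph `G`: a set of ordered pairs (arcs) that contains exactly one
of `(u, v)`, `(v, u)` for every edge `uv` of `G`, and nothing else. -/
structure GraphOrientation {V : Type*} (G : SimpleGraph V) where
  arcs : Finset (V × V)
  adj_iff : ∀ u v, G.Adj u v ↔ (u, v) ∈ arcs ∨ (v, u) ∈ arcs
  asymm : ∀ u v, (u, v) ∈ arcs → (v, u) ∉ arcs

/-- The graph polynomial `∏ (x_v - x_u)`, over the arcs `(u, v)` of the orientation. -/
noncomputable def graphPolynomial {V : Type*} {G : SimpleGraph V} (D : GraphOrientation G) :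
    MvPolynomial V ℝ :=
  ∏ a ∈ D.arcs, (X a.2 - X a.1)

/-- The coefficient `[x^g] p` for an integer exponent vector `g`; it is `0` if some exponent is
negative, since a polynomial has no such monomial. -/
noncomputable def intCoeff {V : Type*} [Fintype V] (g : V → ℤ) (p : MvPolynomial V ℝ) : ℝ :=
  open Classical in
  if ∀ v, 0 ≤ g v then coeff (Finsupp.equivFunOnFinite.symm fun v => (g v).toNat) p else 0

/-- The function `1_v`, equal to `1` at `v` and to `0` elsewhere. -/
def unitVec {V : Type*} [DecidableEq V] (v : V) : V → ℤ := Pi.single v 1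

/-- `G` is `L`-colorable: there is a choice of a color from each list such that adjacent vertices
get different colors. -/
def ListColorable {V : Type*} (G : SimpleGraph V) (L : V → Finset ℝ) : Prop :=
  ∃ φ : V → ℝ, (∀ v, φ v ∈ L v) ∧ ∀ u v, G.Adj u v → φ u ≠ φ v

/-- The characteristic vector of the color `c`. -/
noncomputable def charVec {V : Type*} (L : V → Finset ℝ) (c : ℝ) (v : V) : ℝ :=
  if c ∈ L v then 1 else 0

/-- The sum of `w u v` over all unordered pairs `{u, v}` of distinct vertices, for symmetric `w`. -/
def sumPairs {V : Type*} [Fintype V] [DecidableEq V] (w : V → V → ℝ)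
    (hw : ∀ u v, w u v = w v u) : ℝ :=
  ∑ e : Sym2 V with ¬ e.IsDiag, Sym2.lift ⟨w, hw⟩ e

/-! Recolor: replace each color `a` by a value `t a`, with `t` injective on the colors used. Without
an `L`-coloring, `P_G` vanishes on the whole grid of new values. Weight the point with colors `a v`
by the product over `v` of `t (a v) ^ m v / ∏ (t (a v) - t b)`, with `m v = |L_v| - 1 - f v`. The
moments of these weights are divided differences of powers: they vanish below `f v`, and at `f v`,
`f v + 1`, `f v + 2` they are the complete homogeneous symmetric polynomials of degree 0, 1, 2 in
the values on `L_v`. As `P_G` is homogeneous of degree `∑ f + 2`, only the exponents `f + 1_u + 1_v`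
survive, so a quadratic form in `t` vanishes (`colorForm_eq_zero_of_injOn`). By density it vanishes
for every `t` (`colorForm_eq_zero`). The indicator of `c` gives the first identity, and polarizing
with two indicators gives the second. -/

/-! ### Divided differences of powers -/

/-- The divided difference of `x ^ k` at the nodes `t a`, `a ∈ s`. -/
noncomputable def powDividedDifference (t : ℝ → ℝ) (s : Finset ℝ) (k : ℕ) : ℝ :=
  ∑ a ∈ s, t a ^ k / ∏ b ∈ s.erase a, (t a - t b)

/-- Write `t a = t b + (t a - t b)`: the second summand cancels the factor that `b` adds to the
denominator. -/
lemma powDividedDifference_insert_succ {t : ℝ → ℝ} {s : Finset ℝ} {b : ℝ} (hb : b ∉ s)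
    (ht : Set.InjOn t (insert b s : Finset ℝ)) (k : ℕ) :
    powDividedDifference t (insert b s) (k + 1) =
      t b * powDividedDifference t (insert b s) k + powDividedDifference t s k := by
  unfold powDividedDifference
  rw [Finset.sum_insert hb, Finset.sum_insert hb, mul_add, Finset.mul_sum, add_assoc,
    ← Finset.sum_add_distrib]
  congr 1
  · ring
  · refine Finset.sum_congr rfl fun a ha => ?_
    have hab : b ≠ a := fun h => hb (h ▸ ha)
    have hne : t a - t b ≠ 0 := fun h =>
      hab (ht (by simp) (by simp [ha]) (sub_eq_zero.1 h).symm)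
    have hprod : ∏ c ∈ s.erase a, (t a - t c) ≠ 0 := by
      refine Finset.prod_ne_zero_iff.2 fun c hc h => ?_
      have hc' := Finset.mem_erase.1 hc
      exact hc'.1 (ht (by simp [hc'.2]) (by simp [ha]) (sub_eq_zero.1 h).symm)
    rw [Finset.erase_insert_of_ne hab, Finset.prod_insert (by simp [hb])]
    field_simp
    ring

/-- The divided difference is the coefficient of `x ^ (|s| - 1)` in the Lagrange interpolant of `x ^
k`, which is `x ^ k` itself when `k < |s|`. -/
lemma powDividedDifference_of_lt {t : ℝ → ℝ} {s : Finset ℝ} (ht : Set.InjOn t s) {k : ℕ}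
    (hk : k + 1 < s.card) : powDividedDifference t s k = 0 := by
  have h := Lagrange.coeff_eq_sum ht (P := (Polynomial.X ^ k : Polynomial ℝ))
    (by rw [Polynomial.degree_X_pow]; exact_mod_cast (by omega : k < s.card))
  rw [Polynomial.coeff_X_pow, if_neg (by omega)] at h
  simpa [powDividedDifference] using h.symm

lemma powDividedDifference_of_eq {t : ℝ → ℝ} {s : Finset ℝ} (ht : Set.InjOn t s) {k : ℕ}
    (hk : k + 1 = s.card) : powDividedDifference t s k = 1 := by
  have h := Lagrange.coeff_eq_sum ht (P := (Polynomial.X ^ k : Polynomial ℝ))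
    (by rw [Polynomial.degree_X_pow]; exact_mod_cast (by omega : k < s.card))
  rw [Polynomial.coeff_X_pow, if_pos (by omega)] at h
  simpa [powDividedDifference] using h.symm

lemma powDividedDifference_card {t : ℝ → ℝ} {s : Finset ℝ} (ht : Set.InjOn t s) :
    powDividedDifference t s s.card = ∑ a ∈ s, t a := by
  induction s using Finset.induction_on with
  | empty => simp [powDividedDifference]
  | insert b s hb ih =>
    rw [Finset.card_insert_of_notMem hb, powDividedDifference_insert_succ hb ht,
      powDividedDifference_of_eq ht (by rw [Finset.card_insert_of_notMem hb]),
      ih (ht.mono (by simp)), Finset.sum_insert hb, mul_one]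

lemma powDividedDifference_card_succ {t : ℝ → ℝ} {s : Finset ℝ} (ht : Set.InjOn t s) :
    powDividedDifference t s (s.card + 1) =
      ((∑ a ∈ s, t a) ^ 2 + ∑ a ∈ s, t a ^ 2) / 2 := by
  induction s using Finset.induction_on with
  | empty => simp [powDividedDifference]
  | insert b s hb ih =>
    rw [powDividedDifference_insert_succ hb ht, powDividedDifference_card ht,
      Finset.card_insert_of_notMem hb, ih (ht.mono (by simp)), Finset.sum_insert hb,
      Finset.sum_insert hb]
    ring

/-! ### The graph polynomial -/

lemma GraphOrientation.card_arcs {V : Type*} [Fintype V] [DecidableEq V] {G : SimpleGraph V}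
    [DecidableRel G.Adj] (D : GraphOrientation G) : D.arcs.card = G.edgeFinset.card := by
  refine Finset.card_bij (fun a _ => s(a.1, a.2)) ?_ ?_ ?_
  · rintro ⟨u, v⟩ h
    simpa [D.adj_iff] using Or.inl h
  · rintro ⟨u, v⟩ h ⟨u', v'⟩ h' heq
    rcases Sym2.eq_iff.1 heq with ⟨h1, h2⟩ | ⟨h1, h2⟩
    · exact Prod.ext h1 h2
    · simp only at h1 h2
      subst h1 h2
      exact absurd h' (D.asymm _ _ h)
  · intro e he
    induction e with
    | _ u v =>
      rw [SimpleGraph.mem_edgeFinset, SimpleGraph.mem_edgeSet, D.adj_iff] at he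
      rcases he with h | h
      · exact ⟨(u, v), h, rfl⟩
      · exact ⟨(v, u), h, Sym2.eq_swap⟩

lemma graphPolynomial_isHomogeneous {V : Type*} {G : SimpleGraph V} (D : GraphOrientation G) :
    (graphPolynomial D).IsHomogeneous D.arcs.card := by
  have h := IsHomogeneous.prod D.arcs (fun a : V × V => (X a.2 - X a.1 : MvPolynomial V ℝ))
    (fun _ => 1) (fun a _ => (isHomogeneous_X ℝ a.2).sub (isHomogeneous_X ℝ a.1))
  simpa [graphPolynomial] using h

lemma eval_graphPolynomial_eq_zero {V : Type*} {G : SimpleGraph V} (D : GraphOrientation G)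
    {x : V → ℝ} {u v : V} (h : G.Adj u v) (hx : x u = x v) :
    eval x (graphPolynomial D) = 0 := by
  rw [graphPolynomial, map_prod]
  rcases (D.adj_iff u v).1 h with h | h
  · exact Finset.prod_eq_zero h (by simp [hx])
  · exact Finset.prod_eq_zero h (by simp [hx])

/-! ### Grid sums and the monomials that survive -/

/-- Weighted sums of the values of a polynomial over a grid, expanded along its monomials. -/
lemma sum_piFinset_eval_mul_prod {V : Type*} [Fintype V] [DecidableEq V] (P : MvPolynomial V ℝ)
    (L : V → Finset ℝ) (t : ℝ → ℝ) (w : V → ℝ → ℝ) :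
    ∑ a ∈ Fintype.piFinset L, eval (fun v => t (a v)) P * ∏ v, w v (a v) =
      ∑ d ∈ P.support, coeff d P * ∏ v, ∑ a ∈ L v, t a ^ d v * w v a := by
  simp_rw [eval_eq', Finset.prod_univ_sum, Finset.sum_mul, Finset.mul_sum,
    Finset.prod_mul_distrib]
  rw [Finset.sum_comm]
  simp_rw [mul_assoc]

lemma sym2_eq_of_unitVec_add_eq {V : Type*} [DecidableEq V] {u v u' v' : V}
    (h : unitVec u + unitVec v = unitVec u' + unitVec v') : s(u, v) = s(u', v') := by
  have h1 := congrFun h u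
  have h2 := congrFun h v
  have h3 := congrFun h u'
  have h4 := congrFun h v'
  simp only [unitVec, Pi.add_apply, Pi.single_apply] at h1 h2 h3 h4
  rw [Sym2.eq_iff]
  grind

lemma exists_eq_add_unitVec {V : Type*} [Fintype V] [DecidableEq V] {f g : V → ℤ} {n : ℤ}
    (hn : 0 < n) (hfg : ∀ v, f v ≤ g v) (hsum : ∑ v, g v = ∑ v, f v + n) :
    ∃ u, ∀ v, (f + unitVec u : V → ℤ) v ≤ g v := by
  obtain ⟨u, -, hu⟩ : ∃ u ∈ Finset.univ, f u < g u :=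
    Finset.exists_lt_of_sum_lt (by omega)
  refine ⟨u, fun v => ?_⟩
  rcases eq_or_ne v u with rfl | h
  · simpa [unitVec] using hu
  · simpa [unitVec, h] using hfg v

lemma sum_add_unitVec {V : Type*} [Fintype V] [DecidableEq V] (f : V → ℤ) (u : V) :
    ∑ v, (f + unitVec u : V → ℤ) v = ∑ v, f v + 1 := by
  simp [Finset.sum_add_distrib, unitVec]

lemma exists_eq_add_unitVec_add_unitVec {V : Type*} [Fintype V] [DecidableEq V] {f g : V → ℤ}
    (hfg : ∀ v, f v ≤ g v) (hsum : ∑ v, g v = ∑ v, f v + 2) :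
    ∃ u v, g = f + unitVec u + unitVec v := by
  obtain ⟨u, hu⟩ := exists_eq_add_unitVec two_pos hfg hsum
  obtain ⟨v, hv⟩ := exists_eq_add_unitVec one_pos hu (by rw [sum_add_unitVec]; omega)
  refine ⟨u, v, funext fun w => ?_⟩
  have := (Finset.sum_eq_sum_iff_of_le fun w _ => hv w).1
    (by rw [sum_add_unitVec, sum_add_unitVec]; omega)
  exact (this w (Finset.mem_univ w)).symm

lemma intCoeff_natCast {V : Type*} [Fintype V] (d : V →₀ ℕ) (P : MvPolynomial V ℝ) :
    intCoeff (fun v => (d v : ℤ)) P = coeff d P := by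
  rw [intCoeff, if_pos fun v => Int.natCast_nonneg _]
  congr 1
  ext v
  simp

lemma exists_eq_natCast_of_intCoeff_ne_zero {V : Type*} [Fintype V] {g : V → ℤ}
    {P : MvPolynomial V ℝ} (h : intCoeff g P ≠ 0) : ∃ d : V →₀ ℕ, g = fun v => (d v : ℤ) := by
  unfold intCoeff at h
  split_ifs at h with hg
  · exact ⟨Finsupp.equivFunOnFinite.symm fun v => (g v).toNat, funext fun v => by simp [hg v]⟩
  · exact absurd rfl h

/-- The contribution of the exponents `f + 1_u + 1_v` to a weighted sum over a grid whose weights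
have moments `H v` relative to `f v`. -/
noncomputable def momentTerm {V : Type*} [Fintype V] [DecidableEq V] (f : V → ℤ)
    (P : MvPolynomial V ℝ) (H : V → ℤ → ℝ) : Sym2 V → ℝ :=
  Sym2.lift ⟨fun u v => intCoeff (f + unitVec u + unitVec v) P *
    ∏ w, H w ((f + unitVec u + unitVec v) w), fun u v => by simp only [add_right_comm f]⟩

/-- A nonzero term has exponent at least `f` everywhere and total degree `∑ f + 2`, so it exceeds
`f` by two units, placed at a unique unordered pair, possibly diagonal. -/
lemma sum_coeff_mul_prod_eq_sum_sym2 {V : Type*} [Fintype V] [DecidableEq V] (f : V → ℤ)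
    {P : MvPolynomial V ℝ} {n : ℕ} (hP : P.IsHomogeneous n) (hsum : ∑ v, f v = (n : ℤ) - 2)
    (H : V → ℤ → ℝ) (hH : ∀ v k, k < f v → H v k = 0) :
    ∑ d ∈ P.support, coeff d P * ∏ v, H v (d v) = ∑ e : Sym2 V, momentTerm f P H e := by
  have hdeg : ∀ d, coeff d P ≠ 0 → ∑ v, (d v : ℤ) = n := by
    intro d hd
    have h : d.degree = n := not_not.1 fun h => hd (hP.coeff_eq_zero h)
    rw [Finsupp.degree_eq_sum] at h
    exact_mod_cast h
  symm
  have key : ∀ e : Sym2 V, momentTerm f P H e ≠ 0 → ∃ d : V →₀ ℕ,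
      momentTerm f P H e = coeff d P * ∏ v, H v (d v) ∧
      ∀ u v, e = s(u, v) → f + unitVec u + unitVec v = fun v => (d v : ℤ) := by
    intro e
    induction e with
    | _ u v =>
      intro he
      rw [momentTerm, Sym2.lift_mk] at he ⊢
      obtain ⟨d, hd⟩ := exists_eq_natCast_of_intCoeff_ne_zero (left_ne_zero_of_mul he)
      refine ⟨d, by simp only [hd, intCoeff_natCast], fun u' v' h => ?_⟩
      rw [← hd]
      rcases Sym2.eq_iff.1 h with ⟨rfl, rfl⟩ | ⟨rfl, rfl⟩
      · rfl
      · rw [add_right_comm]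
  choose i hi hi' using key
  refine Finset.sum_bij_ne_zero (fun e _ he => i e he) ?_ ?_ ?_ ?_
  · intro e _ he
    rw [mem_support_iff]
    have := hi e he
    exact left_ne_zero_of_mul (this ▸ he)
  · intro e _ he e' _ he' h
    have h1 := hi' e he
    have h2 := hi' e' he'
    rw [h] at h1
    clear hi hi' h
    induction e with
    | _ u v =>
      induction e' with
      | _ u' v' =>
        apply sym2_eq_of_unitVec_add_eq
        have := (h1 u v rfl).trans (h2 u' v' rfl).symm
        rwa [add_assoc, add_assoc, add_right_inj] at this
  · intro d hd hne
    have hle : ∀ v, f v ≤ (d v : ℤ) := by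
      intro v
      by_contra! hlt
      exact right_ne_zero_of_mul hne (Finset.prod_eq_zero (Finset.mem_univ v) (hH v _ hlt))
    obtain ⟨u, v, huv⟩ := exists_eq_add_unitVec_add_unitVec hle
      (by rw [hdeg d (mem_support_iff.1 hd)]; omega)
    have he : momentTerm f P H s(u, v) ≠ 0 := by
      rw [momentTerm, Sym2.lift_mk]
      simp only [← huv, intCoeff_natCast]
      exact hne
    refine ⟨s(u, v), Finset.mem_univ _, he, ?_⟩
    have := (hi' _ he u v rfl).symm.trans huv.symm
    ext w
    exact_mod_cast congrFun this w
  · intro e _ he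
    exact hi e he

/-! ### Sums over unordered pairs -/

lemma sum_sym2_eq_sumPairs_add_sum {V : Type*} [Fintype V] [DecidableEq V] (w : V → V → ℝ)
    (hw : ∀ u v, w u v = w v u) :
    ∑ e : Sym2 V, Sym2.lift ⟨w, hw⟩ e = sumPairs w hw + ∑ v, w v v := by
  rw [sumPairs, ← Finset.sum_filter_not_add_sum_filter Finset.univ (fun e : Sym2 V => e.IsDiag)]
  congr 1
  refine (Finset.sum_bij (fun v _ => s(v, v)) ?_ ?_ ?_ ?_).symm
  · simp
  · intro u _ v _ h
    simpa using h
  · intro e he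
    induction e with
    | _ u v =>
      obtain rfl : u = v := by simpa using he
      exact ⟨u, Finset.mem_univ _, rfl⟩
  · simp

lemma sumPairs_congr {V : Type*} [Fintype V] [DecidableEq V] {w w' : V → V → ℝ}
    {hw : ∀ u v, w u v = w v u} {hw' : ∀ u v, w' u v = w' v u}
    (h : ∀ u v, u ≠ v → w u v = w' u v) : sumPairs w hw = sumPairs w' hw' := by
  refine Finset.sum_congr rfl fun e he => ?_
  induction e with
  | _ u v => exact h u v (by simpa using he)

lemma sumPairs_add {V : Type*} [Fintype V] [DecidableEq V] {w w' : V → V → ℝ}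
    (hw : ∀ u v, w u v = w v u) (hw' : ∀ u v, w' u v = w' v u) :
    sumPairs w hw + sumPairs w' hw' =
      sumPairs (fun u v => w u v + w' u v) (fun u v => by rw [hw, hw']) := by
  rw [sumPairs, sumPairs, sumPairs, ← Finset.sum_add_distrib]
  refine Finset.sum_congr rfl fun e _ => ?_
  induction e with
  | _ u v => rfl

lemma continuous_sumPairs {V : Type*} [Fintype V] [DecidableEq V] {w : ℝ → V → V → ℝ}
    (hw : ∀ s u v, w s u v = w s v u) (h : ∀ u v, Continuous fun s => w s u v) :
    Continuous fun s => sumPairs (w s) (hw s) := by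
  refine continuous_finsetSum _ fun e _ => ?_
  induction e with
  | _ u v => exact h u v

/-! ### Vanishing of the quadratic form -/

/-- The part of the weighted grid sum that has degree two in the color values `t`. -/
noncomputable def colorForm {V : Type*} [Fintype V] [DecidableEq V] (L : V → Finset ℝ) (f : V → ℤ)
    (P : MvPolynomial V ℝ) (t : ℝ → ℝ) : ℝ :=
  sumPairs (fun u v => intCoeff (f + unitVec u + unitVec v) P *
      ((∑ a ∈ L u, t a) * ∑ a ∈ L v, t a))
    (fun u v => by rw [add_right_comm, mul_comm (∑ a ∈ L u, t a)])
  + ∑ v, intCoeff (f + unitVec v + unitVec v) P *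
      (((∑ a ∈ L v, t a) ^ 2 + ∑ a ∈ L v, t a ^ 2) / 2)

lemma colorForm_eq_zero_of_injOn {V : Type*} [Fintype V] [DecidableEq V] {G : SimpleGraph V}
    [DecidableRel G.Adj] (D : GraphOrientation G) (L : V → Finset ℝ) (f : V → ℤ)
    (hf : ∀ v, f v < ((L v).card : ℤ)) (hsum : ∑ v, f v = (G.edgeFinset.card : ℤ) - 2)
    (hG : ¬ ListColorable G L) {t : ℝ → ℝ} (ht : Set.InjOn t (Finset.univ.biUnion L)) :
    colorForm L f (graphPolynomial D) t = 0 := by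
  have htL : ∀ v, Set.InjOn t (L v) := fun v => ht.mono (by
    intro a ha
    simpa using ⟨v, ha⟩)
  let m : V → ℕ := fun v => ((L v).card - 1 - f v).toNat
  have hm : ∀ v, (m v : ℤ) = (L v).card - 1 - f v := fun v =>
    Int.toNat_of_nonneg (by have := hf v; omega)
  -- The cutoff forces vanishing below `f v` also for negative `k`, where `k.toNat` carries no
  -- information.
  let H : V → ℤ → ℝ := fun v k =>
    if k < f v then 0 else powDividedDifference t (L v) (k.toNat + m v)
  have hH : ∀ v k, k < f v → H v k = 0 := fun v k h => if_pos h
  have hH0 : ∀ v, 0 ≤ f v → H v (f v) = 1 := by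
    intro v hv
    have := hm v
    simp only [H, lt_irrefl, if_false]
    exact powDividedDifference_of_eq (htL v) (by omega)
  have hH1 : ∀ v, 0 ≤ f v + 1 → H v (f v + 1) = ∑ a ∈ L v, t a := by
    intro v hv
    have := hm v
    simp only [H]
    rw [if_neg (by omega), ← powDividedDifference_card (htL v)]
    congr 1
    omega
  have hH2 : ∀ v, 0 ≤ f v + 2 →
      H v (f v + 2) = ((∑ a ∈ L v, t a) ^ 2 + ∑ a ∈ L v, t a ^ 2) / 2 := by
    intro v hv
    have := hm v
    simp only [H]
    rw [if_neg (by omega), ← powDividedDifference_card_succ (htL v)]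
    congr 1
    omega
  have hmoment : ∀ v (k : ℕ),
      ∑ a ∈ L v, t a ^ k * (t a ^ m v / ∏ b ∈ (L v).erase a, (t a - t b)) = H v k := by
    intro v k
    have h1 : ∑ a ∈ L v, t a ^ k * (t a ^ m v / ∏ b ∈ (L v).erase a, (t a - t b)) =
        powDividedDifference t (L v) (k + m v) :=
      Finset.sum_congr rfl fun a _ => by rw [pow_add, mul_div_assoc]
    rw [h1]
    simp only [H]
    split_ifs with hk
    · have := hm v
      exact powDividedDifference_of_lt (htL v) (by omega)
    · simp
  have hgrid := sum_piFinset_eval_mul_prod (graphPolynomial D) L t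
    (fun v a => t a ^ m v / ∏ b ∈ (L v).erase a, (t a - t b))
  simp_rw [hmoment] at hgrid
  rw [sum_coeff_mul_prod_eq_sum_sym2 f (D.card_arcs ▸ graphPolynomial_isHomogeneous D) hsum H hH,
    Finset.sum_eq_zero] at hgrid
  · rw [hgrid]
    unfold momentTerm
    rw [sum_sym2_eq_sumPairs_add_sum, colorForm]
    congr 1
    · refine sumPairs_congr fun u v huv => ?_
      -- `f` may be negative; a nonzero coefficient makes all exponents nonnegative, as the moment
      -- formulas require.
      by_cases hc : intCoeff (f + unitVec u + unitVec v) (graphPolynomial D) = 0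
      · rw [hc, zero_mul, zero_mul]
      obtain ⟨d, hd⟩ := exists_eq_natCast_of_intCoeff_ne_zero hc
      have hnn : ∀ w, 0 ≤ (f + unitVec u + unitVec v) w := fun w => by
        rw [hd]; exact Int.natCast_nonneg _
      congr 1
      rw [Finset.prod_eq_mul u v huv]
      · have hu := hnn u
        have hv := hnn v
        simp only [unitVec, Pi.add_apply, Pi.single_eq_same, Pi.single_eq_of_ne huv,
          Pi.single_eq_of_ne huv.symm, add_zero] at hu hv ⊢
        rw [hH1 u hu, hH1 v hv]
      · rintro w - ⟨hwu, hwv⟩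
        have hw := hnn w
        simp only [unitVec, Pi.add_apply, Pi.single_eq_of_ne hwu,
          Pi.single_eq_of_ne hwv, add_zero] at hw ⊢
        exact hH0 w hw
      · simp
      · simp
    · refine Finset.sum_congr rfl fun v _ => ?_
      by_cases hc : intCoeff (f + unitVec v + unitVec v) (graphPolynomial D) = 0
      · rw [hc, zero_mul, zero_mul]
      obtain ⟨d, hd⟩ := exists_eq_natCast_of_intCoeff_ne_zero hc
      have hnn : ∀ w, 0 ≤ (f + unitVec v + unitVec v) w := fun w => by
        rw [hd]; exact Int.natCast_nonneg _
      congr 1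
      rw [Finset.prod_eq_single v]
      · have hv := hnn v
        simp only [unitVec, Pi.add_apply, Pi.single_eq_same, add_assoc, one_add_one_eq_two]
          at hv ⊢
        rw [hH2 v hv]
      · rintro w - hwv
        have hw := hnn w
        simp only [unitVec, Pi.add_apply, Pi.single_eq_of_ne hwv, add_zero] at hw ⊢
        exact hH0 w hw
      · simp
  · intro φ hφ
    rw [Fintype.mem_piFinset] at hφ
    obtain ⟨u, v, huv, heq⟩ : ∃ u v, G.Adj u v ∧ φ u = φ v := by
      by_contra! h
      exact hG ⟨φ, hφ, h⟩
    rw [eval_graphPolynomial_eq_zero D huv (by simp only [heq]), zero_mul]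

/-- All but finitely many translates `t + s • id` are injective on a finite set of reals. -/
lemma finite_setOf_not_injOn_add_mul (t : ℝ → ℝ) (U : Finset ℝ) :
    {s : ℝ | ¬ Set.InjOn (fun a => t a + s * a) U}.Finite := by
  refine ((U ×ˢ U).image fun p => (t p.2 - t p.1) / (p.1 - p.2)).finite_toSet.subset ?_
  intro s hs
  simp only [Set.InjOn, Set.mem_ofPred_eq, not_forall] at hs
  obtain ⟨a, ha, b, hb, hab, hne⟩ := hs
  rw [Finset.mem_coe, Finset.mem_image]
  refine ⟨(a, b), Finset.mem_product.2 ⟨ha, hb⟩, ?_⟩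
  rw [div_eq_iff (sub_ne_zero.2 hne)]
  linarith

/-- The form is continuous along the line `t + s • id`, vanishes for all but finitely many `s`, and
hence vanishes at `s = 0`. -/
lemma colorForm_eq_zero {V : Type*} [Fintype V] [DecidableEq V] {G : SimpleGraph V}
    [DecidableRel G.Adj] (D : GraphOrientation G) (L : V → Finset ℝ) (f : V → ℤ)
    (hf : ∀ v, f v < ((L v).card : ℤ)) (hsum : ∑ v, f v = (G.edgeFinset.card : ℤ) - 2)
    (hG : ¬ ListColorable G L) (t : ℝ → ℝ) :
    colorForm L f (graphPolynomial D) t = 0 := by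
  have hcont : Continuous fun s : ℝ =>
      colorForm L f (graphPolynomial D) (fun a => t a + s * a) := by
    unfold colorForm
    refine Continuous.add (continuous_sumPairs _ fun u v => ?_) ?_ <;> fun_prop
  have hdense := (finite_setOf_not_injOn_add_mul t (Finset.univ.biUnion L)).countable.dense_compl ℝ
  have h := hcont.ext_on hdense continuous_const (g := fun _ => (0 : ℝ)) (fun s hs =>
    colorForm_eq_zero_of_injOn D L f hf hsum hG (not_not.1 hs))
  simpa using congrFun h 0

/-! ### Indicators of colors and polarization -/

lemma sum_ite_eq_charVec {V : Type*} (L : V → Finset ℝ) (c : ℝ) (v : V) :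
    ∑ a ∈ L v, (if a = c then 1 else 0 : ℝ) = charVec L c v := by
  simp [charVec]

lemma charVec_sq {V : Type*} (L : V → Finset ℝ) (c : ℝ) (v : V) :
    charVec L c v ^ 2 = charVec L c v := by
  simp [charVec]

lemma colorForm_ite {V : Type*} [Fintype V] [DecidableEq V] (L : V → Finset ℝ) (f : V → ℤ)
    (P : MvPolynomial V ℝ) (c : ℝ) :
    colorForm L f P (fun a => if a = c then 1 else 0) =
      sumPairs (fun u v => intCoeff (f + unitVec u + unitVec v) P *
          (charVec L c u * charVec L c v))
        (fun u v => by rw [add_right_comm, mul_comm (charVec L c u)])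
      + ∑ v, intCoeff (f + 2 • unitVec v) P * charVec L c v := by
  simp only [colorForm, ite_pow, one_pow, ne_eq, OfNat.ofNat_ne_zero, not_false_eq_true, zero_pow,
    sum_ite_eq_charVec, charVec_sq, add_self_div_two, two_nsmul, add_assoc]

lemma colorForm_ite_add_ite {V : Type*} [Fintype V] [DecidableEq V] (L : V → Finset ℝ) (f : V → ℤ)
    (P : MvPolynomial V ℝ) {c₁ c₂ : ℝ} (hc : c₁ ≠ c₂) :
    colorForm L f P (fun a => (if a = c₁ then 1 else 0) + if a = c₂ then 1 else 0) =
      colorForm L f P (fun a => if a = c₁ then 1 else 0) +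
      colorForm L f P (fun a => if a = c₂ then 1 else 0) +
      (sumPairs (fun u v => intCoeff (f + unitVec u + unitVec v) P *
          (charVec L c₁ u * charVec L c₂ v + charVec L c₂ u * charVec L c₁ v))
        (fun u v => by rw [add_right_comm]; ring)
      + ∑ v, intCoeff (f + 2 • unitVec v) P * (charVec L c₁ v * charVec L c₂ v)) := by
  -- Distinct colors have disjoint indicators, so the sum of squares contributes no cross term.
  have hsq : ∀ a : ℝ, ((if a = c₁ then 1 else 0) + if a = c₂ then 1 else 0 : ℝ) ^ 2 =
      (if a = c₁ then 1 else 0) + if a = c₂ then 1 else 0 := by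
    intro a
    split_ifs with h1 h2
    · exact absurd (h1.symm.trans h2) hc
    all_goals norm_num
  rw [colorForm_ite, colorForm_ite, add_add_add_comm (sumPairs _ _) _ (sumPairs _ _) _,
    add_add_add_comm, sumPairs_add,
    sumPairs_add, ← Finset.sum_add_distrib, ← Finset.sum_add_distrib, colorForm]
  simp only [hsq, Finset.sum_add_distrib (s := L _), sum_ite_eq_charVec]
  congr 1
  · exact sumPairs_congr fun u v _ => by ring
  · refine Finset.sum_congr rfl fun v _ => ?_
    have h : f + 2 • unitVec v = f + unitVec v + unitVec v := by rw [two_nsmul, add_assoc]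
    rw [h]
    linear_combination (intCoeff (f + unitVec v + unitVec v) P / 2) *
      (charVec_sq L c₁ v + charVec_sq L c₂ v)

theorem theorem6 {V : Type*} [Fintype V] [DecidableEq V] (G : SimpleGraph V) [DecidableRel G.Adj]
    (D : GraphOrientation G) (L : V → Finset ℝ) (f : V → ℤ)
    (hf : ∀ v, f v < ((L v).card : ℤ))
    (hsum : ∑ v, f v = (G.edgeFinset.card : ℤ) - 2)
    (hG : ¬ ListColorable G L) :
    (∀ c : ℝ,
      sumPairs
          (fun u v => intCoeff (f + unitVec u + unitVec v) (graphPolynomial D) *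
            (charVec L c u * charVec L c v))
          (fun u v => by rw [add_right_comm, mul_comm (charVec L c u)])
        + ∑ v, intCoeff (f + 2 • unitVec v) (graphPolynomial D) * charVec L c v = 0) ∧
    (∀ c₁ c₂ : ℝ, c₁ ≠ c₂ →
      sumPairs
          (fun u v => intCoeff (f + unitVec u + unitVec v) (graphPolynomial D) *
            (charVec L c₁ u * charVec L c₂ v + charVec L c₂ u * charVec L c₁ v))
          (fun u v => by rw [add_right_comm]; ring)
        + ∑ v, intCoeff (f + 2 • unitVec v) (graphPolynomial D) *
            (charVec L c₁ v * charVec L c₂ v) = 0) := by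
  have h := colorForm_eq_zero D L f hf hsum hG
  refine ⟨fun c => ?_, fun c₁ c₂ hc => ?_⟩
  · rw [← colorForm_ite]
    exact h _
  · have h12 := colorForm_ite_add_ite L f (graphPolynomial D) hc
    rw [h, h, h, add_zero, zero_add] at h12
    exact h12.symm
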